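/- Let $(W,S)$ be a Coxeter system (of arbitrary, possibly infinite, rank), with length function $l=l_S$ and set of reflections $T=\{wsw^{-1}\mid w\in W,\ s\in S\}$. **Definitions.** A *protorootoid* over a group $G$ is a triple $(G,\Lambda,N)$, where $\Lambda$ is a (not necessarily unital) Boolean ring on which $G$ acts by ring automorphisms and $N\colon G\to\Lambda$ satisfies $N(gh)=N(g)+gN(h)$. It is *faithful* if $N(g)=0$ implies $g=1$, and *cocycle finite* if every $N(g)$ has finite rank in $\Lambda$. Its *weak order* is the relation $x\le y\iff N(x)\subseteq N(y)$ on $G$. It is a *rootoid* if it is faithful, every non-empty subset of $G$ has a meet in the weak order, and, whenever a subset $A\subseteq G$ has a join $m$ and $y\in G$ satisfies $N(x)\cap N(y)=0$ for all $x\in A$, also $N(m)\cap N(y)=0$. It is *principal*, with set of *simple generators* $R=\{g\in G\mid \operatorname{rank}N(g)=1\}$, if it is faithful and cocycle finite, $R$ generates $G$, and $\operatorname{rank}N(g)=l_R(g)$ for all $g\in G$. Let $G$ be a group and $S\subseteq G$ a generating set with $S=S^{-1}$ and $1\notin S$ (a *$C_0$-system*). It is *even* if there is a homomorphism $G\to\{\pm1\}$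 taking the value $-1$ at every $s\in S$. For $s\in S$ put $G_s^{>}=\{g\in G\mid l_S(s^{-1}g)>l_S(g)\}$; let $\Psi=\{gG_s^{>}\mid g\in G,\ s\in S\}$, with $G$ acting by left translation, $\Psi'=\{A\in\Psi\mid 1\in A\}$, $N(g)=\Psi'+g\Psi'$ (symmetric difference), and $\mathcal J_{(G,S)}=(G,\wp(\Psi),N)$, where $\wp(\Psi)$ is the Boolean ring of subsets of $\Psi$. The pair $(G,S)$ satisfies the *weak exchange condition* (WEC) if $|N(g)|=2l_S(g)$ for all $g\in G$; it is a *$C_2$-system* if it satisfies WEC and $\mathcal J_{(G,S)}$ is a rootoid. If $(G,S)$ is even, then $\Psi$ is stable under complementation, and $\widehat\Psi$ denotes the signed $G$-set $\Psi$ with $-A=G\setminus A$ and with $\Psi'$ as its set of positive elements; $\overline{\mathcal J}_{(G,S)}=(G,\wp(\widehat\Psi/\{\pm\}),\overline N)$ is the associated protorootoid, with $\overline N(g)=\{\{\pm A\}\mid A\in\widehat\Psi_+\cap g\widehat\Psi_-\}$. The *abstract root system* of $(W,S)$ is the signed $W$-set $\Phi=T\times\{\pm\}$ with $-(t,\epsilon)=(t,-\epsilon)$,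 positive elements $T\times\{+\}$, and the $W$-action determined by $s(t,\epsilon)=(sts,\epsilon)$ for $s\in S$, $t\in T\setminus\{s\}$, and $s(s,\epsilon)=(s,-\epsilon)$. **Proposition.** 1. $(W,S)$ is an even $C_2$-system; that is, it is an even $C_0$-system, it satisfies WEC, and $\mathcal J_{(W,S)}$ is a rootoid. 2. There is a unique map $f\colon\Phi\to\widehat\Psi$, commuting with the actions of $W$ and of $\{\pm\}$, such that $f(s,+)=G_s^{>}$ (with $G=W$) for all $s\in S$. It is an isomorphism of signed $W$-sets, that is, it is bijective, and $f(x)$ is positive if and only if $x$ is. It is given by $f(t,+)=\{w\in W\mid l(tw)>l(w)\}$ and $f(t,-)=\{w\in W\mid l(tw)<l(w)\}$ for $t\in T$. 3. $\overline{\mathcal J}_{(W,S)}$ is a rootoid and is principal, with set of simple generators $S$. -/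

import Mathlib

section SignedSets

open scoped Pointwise

universe u

/-! Groups are regarded as groupoids with one object, so that functors from the groupoid to sets
(Boolean rings) are sets (Boolean rings) on which the group acts. -/

/-- A protorootoid `(G, Λ, N)`: a Boolean ring `Λ` (not necessarily unital) on which `G` acts by
ring automorphisms, with a cocycle `N : G → Λ`.  A Boolean ring is given here as the corresponding
generalized Boolean algebra: its sum is the symmetric difference and its product is the meet. -/
structure Protorootoid (G : Type u) [Group G] where
  Λ : Type u
  [algebra : GeneralizedBooleanAlgebra Λ]
  [action : MulAction G Λ]
  smul_symmDiff : ∀ (g : G) (x y : Λ), g • symmDiff x y = symmDiff (g • x) (g • y)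
  smul_inf : ∀ (g : G) (x y : Λ), g • (x ⊓ y) = (g • x) ⊓ (g • y)
  N : G → Λ
  N_mul : ∀ g h : G, N (g * h) = symmDiff (N g) (g • N h)

attribute [instance] Protorootoid.algebra Protorootoid.action

/-- A set protorootoid `(G, Ψ, N)`: a `G`-set `Ψ` and a `G`-cocycle `N` with values in the Boolean
ring of subsets of `Ψ`. -/
structure SetProtorootoid (G : Type u) [Group G] where
  Ψ : Type u
  [action : MulAction G Ψ]
  N : G → Set Ψ
  N_mul : ∀ g h : G, N (g * h) = symmDiff (N g) (g • N h)

attribute [instance] SetProtorootoid.action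

/-- A (definitely) signed `G`-set: a set with commuting actions of `G` and of the sign group, the
latter given by the involution `neg`, and with a subset `pos` of positive elements which contains
exactly one of `x` and `neg x` for each `x`. -/
structure SignedGSet (G : Type u) [Group G] where
  carrier : Type u
  [action : MulAction G carrier]
  neg : carrier → carrier
  neg_neg : ∀ x, neg (neg x) = x
  smul_neg : ∀ (g : G) (x : carrier), g • neg x = neg (g • x)
  pos : Set carrier
  neg_mem_pos : ∀ x, neg x ∈ pos ↔ x ∉ pos

attribute [instance] SignedGSet.action

/-! ### Length functions and half-spaces of a group with a set of generators -/

/-- The length of `g` with respect to `S` (for `S` generating `G` as a monoid). -/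
noncomputable def wordLength {G : Type u} [Group G] (S : Set G) (g : G) : ℕ :=
  sInf {n | ∃ L : List G, (∀ x ∈ L, x ∈ S) ∧ L.prod = g ∧ L.length = n}

/-- `(G, S)` is a `C₀`-system. -/
structure IsC0System {G : Type u} [Group G] (S : Set G) : Prop where
  closure_eq_top : Subgroup.closure S = ⊤
  inv_mem : ∀ s ∈ S, s⁻¹ ∈ S
  one_notMem : (1 : G) ∉ S

/-- `(G, S)` is an even `C₀`-system: it has a sign character. -/
structure IsEvenC0System {G : Type u} [Group G] (S : Set G) : Prop extends IsC0System S where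
  exists_sign : ∃ ε : G →* ℤˣ, ∀ s ∈ S, ε s = -1

/-- The set `G_s^>` of those `g` with `l(s⁻¹ g) > l(g)`. -/
def posHalf {G : Type u} [Group G] (S : Set G) (s : G) : Set G :=
  {g | wordLength S g < wordLength S (s⁻¹ * g)}

/-- The set of all translates `g G_s^>`, for `g ∈ G` and `s ∈ S`. -/
def halfSpaces {G : Type u} [Group G] (S : Set G) : Set (Set G) :=
  {A | ∃ g : G, ∃ s ∈ S, A = g • posHalf S s}

theorem smul_mem_halfSpaces {G : Type u} [Group G] {S : Set G} (g : G) {A : Set G}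
    (hA : A ∈ halfSpaces S) : g • A ∈ halfSpaces S := by
  obtain ⟨h, s, hs, rfl⟩ := hA
  exact ⟨g * h, s, hs, by rw [mul_smul]⟩

/-- `G` acts on the set of half-spaces by left translation. -/
instance halfSpacesAction {G : Type u} [Group G] (S : Set G) :
    MulAction G (halfSpaces S) where
  smul g A := ⟨g • (A : Set G), smul_mem_halfSpaces g A.2⟩
  one_smul A := Subtype.ext (one_smul G (A : Set G))
  mul_smul g h A := Subtype.ext (mul_smul g h (A : Set G))

/-- The set protorootoid `J'` of `(G, S)`, with the coboundary `N(g) = Ψ' + g Ψ'`, where `Ψ'` is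
the set of half-spaces that contain `1`. -/
def setProtorootoidOf {G : Type u} [Group G] (S : Set G) : SetProtorootoid G where
  Ψ := halfSpaces S
  N g := symmDiff {A : halfSpaces S | (1 : G) ∈ (A : Set G)}
    (g • {A : halfSpaces S | (1 : G) ∈ (A : Set G)})
  N_mul g h := by
    rw [Set.smul_set_symmDiff, smul_smul, symmDiff_assoc, symmDiff_symmDiff_cancel_left]

/-- The protorootoid `(G, ℘(Ψ), N)` of a set protorootoid `(G, Ψ, N)`. -/
def SetProtorootoid.toProtorootoid {G : Type u} [Group G] (R : SetProtorootoid G) :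
    Protorootoid G where
  Λ := Set R.Ψ
  algebra := inferInstance
  action := inferInstance
  smul_symmDiff _ _ _ := Set.smul_set_symmDiff
  smul_inf _ _ _ := Set.smul_set_inter
  N := R.N
  N_mul := R.N_mul

namespace Protorootoid

variable {G : Type u} [Group G] (R : Protorootoid G)

/-- The weak (pre)order on `G`. -/
def WeakLE (x y : G) : Prop := R.N x ≤ R.N y

/-- `m` is a greatest lower bound of `A` in the weak order. -/
def IsMeet (A : Set G) (m : G) : Prop :=
  (∀ x ∈ A, R.WeakLE m x) ∧ ∀ z, (∀ x ∈ A, R.WeakLE z x) → R.WeakLE z m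

/-- `m` is a least upper bound of `A` in the weak order. -/
def IsJoin (A : Set G) (m : G) : Prop :=
  (∀ x ∈ A, R.WeakLE x m) ∧ ∀ z, (∀ x ∈ A, R.WeakLE x z) → R.WeakLE m z

/-- Faithfulness: only the identity has value `0` under the cocycle. -/
def IsFaithful : Prop := ∀ g, R.N g = ⊥ → g = 1

/-- A rootoid is a faithful protorootoid whose weak order is a complete meet semilattice (every
non-empty subset has a meet) and which has the join orthogonality property: if `y` is orthogonal
to every element of a set that has a join, then `y` is orthogonal to the join. -/
structure IsRootoid : Prop where
  faithful : R.IsFaithful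
  exists_meet : ∀ A : Set G, A.Nonempty → ∃ m, R.IsMeet A m
  join_orthogonality : ∀ (A : Set G) (m y : G), R.IsJoin A m →
    (∀ x ∈ A, R.N x ⊓ R.N y = ⊥) → R.N m ⊓ R.N y = ⊥

/-- The rank of `N(g)` in the poset `Λ`, that is, the supremum of the lengths of the chains that
end in `N(g)`. -/
noncomputable def rank (g : G) : ℕ∞ := Order.height (R.N g)

/-- All the values of the cocycle have finite rank. -/
def IsCocycleFinite : Prop := ∀ g, R.rank g ≠ ⊤

/-- The simple elements: those whose value under the cocycle has rank one. -/
def simples : Set G := {g | R.rank g = 1}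

/-- A principal protorootoid: it is faithful and cocycle finite, the simple elements generate the
group, and the length function for these generators is the rank of the cocycle. -/
structure IsPrincipal : Prop where
  faithful : R.IsFaithful
  cocycleFinite : R.IsCocycleFinite
  closure_simples : Subgroup.closure R.simples = ⊤
  rank_eq : ∀ g, R.rank g = wordLength R.simples g

end Protorootoid

/-- `(G, S)` is a `C₁`-system: the weak exchange condition (WEC) holds. -/
structure IsC1System {G : Type u} [Group G] (S : Set G) : Prop extends IsC0System S where
  cocycleFinite : (setProtorootoidOf S).toProtorootoid.IsCocycleFinite
  rank_eq : ∀ g, (setProtorootoidOf S).toProtorootoid.rank g = 2 * wordLength S g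

/-- `(G, S)` is a `C₂`-system. -/
structure IsC2System {G : Type u} [Group G] (S : Set G) : Prop extends IsC1System S where
  isRootoid : (setProtorootoidOf S).toProtorootoid.IsRootoid

namespace IsEvenC0System

variable {G : Type u} [Group G] {S : Set G}

theorem wordLength_ne (h : IsEvenC0System S) {s : G} (hs : s ∈ S) (g : G) :
    wordLength S (s⁻¹ * g) ≠ wordLength S g := by
  obtain ⟨ε, hε⟩ := h.exists_sign
  have key : ∀ g : G, ε g = (-1) ^ wordLength S g := by
    intro g
    have hne : {n | ∃ L : List G, (∀ x ∈ L, x ∈ S) ∧ L.prod = g ∧ L.length = n}.Nonempty := by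
      have hg : g ∈ (Subgroup.closure S).toSubmonoid := by
        rw [h.closure_eq_top]; trivial
      rw [Subgroup.closure_toSubmonoid] at hg
      obtain ⟨L, hL, hp⟩ := Submonoid.exists_list_of_mem_closure hg
      refine ⟨_, L, fun x hx => ?_, hp, rfl⟩
      rcases hL x hx with hx' | hx'
      · exact hx'
      · simpa using h.inv_mem _ hx'
    obtain ⟨L, hL, hp, hl⟩ := Nat.sInf_mem hne
    have : ∀ L : List G, (∀ x ∈ L, x ∈ S) → ε L.prod = (-1) ^ L.length := by
      intro L
      induction L with
      | nil => simp
      | cons a L ih =>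
        intro hL
        rw [List.prod_cons, map_mul, hε a (hL a (by simp)),
          ih (fun x hx => hL x (by simp [hx])), List.length_cons, pow_succ']
    rw [← hp, this L hL, hl, hp]
    rfl
  intro heq
  have h1 : ε (s⁻¹ * g) = ε g := by rw [key, key g, heq]
  rw [map_mul, hε _ (h.inv_mem s hs)] at h1
  have h2 : (-1 : ℤˣ) = 1 := mul_eq_right.1 h1
  exact absurd h2 (by decide)

theorem compl_mem (h : IsEvenC0System S) {A : Set G} (hA : A ∈ halfSpaces S) :
    Aᶜ ∈ halfSpaces S := by
  obtain ⟨g, s, hs, rfl⟩ := hA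
  refine ⟨g * s, s⁻¹, h.inv_mem s hs, ?_⟩
  rw [mul_smul, ← Set.smul_set_compl]
  congr 1
  ext x
  have := h.wordLength_ne hs x
  simp only [Set.mem_smul_set_iff_inv_smul_mem, posHalf, Set.mem_compl_iff, Set.mem_ofPred_eq,
    smul_eq_mul, inv_inv, mul_inv_cancel_left]
  omega

/-- The signed `G`-set of half-spaces of an even `C₀`-system: the negative of a half-space is its
complement, and the positive half-spaces are those that contain `1`. -/
def signedHalfSpaces (h : IsEvenC0System S) : SignedGSet G where
  carrier := halfSpaces S
  action := halfSpacesAction S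
  neg A := ⟨(A : Set G)ᶜ, h.compl_mem A.2⟩
  neg_neg _ := Subtype.ext (compl_compl _)
  smul_neg _ _ := Subtype.ext Set.smul_set_compl
  pos := {A | (1 : G) ∈ (A : Set G)}
  neg_mem_pos _ := Iff.rfl

end IsEvenC0System

namespace SignedGSet

variable {G : Type u} [Group G] (Φ : SignedGSet G)

/-- The orbits of the sign group. -/
def signSetoid : Setoid Φ.carrier where
  r x y := x = y ∨ x = Φ.neg y
  iseqv :=
    { refl := fun _ => Or.inl rfl
      symm := by
        rintro x y (rfl | rfl)
        · exact Or.inl rfl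
        · exact Or.inr (Φ.neg_neg _).symm
      trans := by
        rintro x y z (rfl | rfl) (rfl | rfl)
        · exact Or.inl rfl
        · exact Or.inr rfl
        · exact Or.inr rfl
        · exact Or.inl (Φ.neg_neg _) }

/-- The induced action of `G` on the set of orbits of the sign group. -/
instance quotientAction : MulAction G (Quotient Φ.signSetoid) where
  smul g := Quotient.map (fun x => g • x) (by
    rintro x y (rfl | rfl)
    · exact Or.inl rfl
    · exact Or.inr (Φ.smul_neg _ _))
  one_smul := by
    rintro ⟨x⟩
    exact congrArg (Quotient.mk Φ.signSetoid) (one_smul G x)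
  mul_smul := by
    rintro g h ⟨x⟩
    exact congrArg (Quotient.mk Φ.signSetoid) (mul_smul g h x)

/-- The set `Φ_g = Φ₊ ∩ g Φ₋`. -/
def inversions (g : G) : Set Φ.carrier := Φ.pos ∩ g • (Φ.pos)ᶜ

theorem mk_mem_iff (g : G) (x : Φ.carrier) :
    Quotient.mk Φ.signSetoid x ∈ Quotient.mk Φ.signSetoid '' Φ.inversions g ↔
      Xor (x ∈ Φ.pos) (g⁻¹ • x ∈ Φ.pos) := by
  constructor
  · rintro ⟨y, ⟨hy, hy'⟩, hxy⟩
    rw [Set.mem_smul_set_iff_inv_smul_mem, Set.mem_compl_iff] at hy'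
    rcases Quotient.exact hxy with h | h
    · subst h
      exact Or.inl ⟨hy, hy'⟩
    · subst h
      rw [Φ.smul_neg, Φ.neg_mem_pos, not_not] at hy'
      exact Or.inr ⟨hy', (Φ.neg_mem_pos _).1 hy⟩
  · rintro (⟨h1, h2⟩ | ⟨h1, h2⟩)
    · exact ⟨x, ⟨h1, by rwa [Set.mem_smul_set_iff_inv_smul_mem]⟩, rfl⟩
    · refine ⟨Φ.neg x, ⟨(Φ.neg_mem_pos x).2 h2, ?_⟩, Quotient.sound (Or.inr rfl)⟩
      rw [Set.mem_smul_set_iff_inv_smul_mem, Φ.smul_neg, Set.mem_compl_iff, Φ.neg_mem_pos,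
        not_not]
      exact h1

/-- The set protorootoid of a signed `G`-set: the `G`-set of orbits of the sign group, with
`N(g)` the set of orbits of the elements of `Φ_g`. -/
def toSetProtorootoid : SetProtorootoid G where
  Ψ := Quotient Φ.signSetoid
  action := Φ.quotientAction
  N g := Quotient.mk Φ.signSetoid '' Φ.inversions g
  N_mul g h := by
    ext q
    induction q using Quotient.inductionOn with
    | h x =>
      have hs : g⁻¹ • Quotient.mk Φ.signSetoid x = Quotient.mk Φ.signSetoid (g⁻¹ • x) := rfl
      rw [Set.mem_symmDiff, Set.mem_smul_set_iff_inv_smul_mem, hs, mk_mem_iff, mk_mem_iff,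
        mk_mem_iff, mul_inv_rev, mul_smul]
      unfold Xor
      tauto

variable {Φ} {Φ' : SignedGSet G}

/-- Maps that commute with the actions of `G` and of the sign group. -/
structure IsHom (f : Φ.carrier → Φ'.carrier) : Prop where
  map_smul : ∀ (g : G) (x : Φ.carrier), f (g • x) = g • f x
  map_neg : ∀ x : Φ.carrier, f (Φ.neg x) = Φ'.neg (f x)

/-- Isomorphisms of signed `G`-sets: bijective equivariant maps that preserve and reflect
positivity. -/
structure IsIso (f : Φ.carrier → Φ'.carrier) : Prop extends IsHom f where
  bijective : Function.Bijective f
  mem_pos_iff : ∀ x : Φ.carrier, f x ∈ Φ'.pos ↔ x ∈ Φ.pos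

end SignedGSet

theorem height_set_eq_encard {α : Type u} (A : Set α) : Order.height A = A.encard := by
  have hfin : ∀ (n : ℕ) (F : Finset α), F.card = n → Order.height (F : Set α) = n := by
    intro n
    induction n with
    | zero =>
      intro F hF
      rw [Finset.card_eq_zero] at hF
      subst hF
      simp
    | succ n ih =>
      intro F hF
      apply le_antisymm
      · refine Order.height_le_coe_iff.2 fun y hy => ?_
        obtain ⟨a, haF, hay⟩ := Set.exists_of_ssubset hy
        classical
        have hle : y ≤ ((F.erase a : Finset α) : Set α) := by
          intro z hz
          rw [Finset.coe_erase]
          exact ⟨hy.1 hz, fun h => hay (h ▸ hz)⟩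
        refine lt_of_le_of_lt (Order.height_mono hle) ?_
        rw [ih _ (by rw [Finset.card_erase_of_mem haF, hF]; rfl)]
        exact_mod_cast Nat.lt_succ_self n
      · classical
        obtain ⟨a, F', ha, rfl, hc⟩ := Finset.card_eq_succ.1 hF
        rw [Nat.cast_succ, ← ih F' hc]
        apply Order.height_add_one_le
        exact_mod_cast Finset.ssubset_insert ha
  by_cases hA : A.Finite
  · obtain ⟨F, rfl⟩ := hA.exists_finset_coe
    rw [hfin _ F rfl, Set.encard_coe_eq_coe_finsetCard]
  · rw [Set.encard_eq_top hA, ENat.eq_top_iff_forall_ge]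
    intro n
    obtain ⟨F, hF, hc⟩ := Set.Infinite.exists_subset_card_eq hA n
    rw [← hfin n F hc]
    exact Order.height_mono hF

/-- The rank of `N(g)` in the Boolean ring of subsets is the cardinality of `N(g)`. -/
theorem SetProtorootoid.rank_eq_encard {G : Type u} [Group G] (R : SetProtorootoid G) (g : G) :
    R.toProtorootoid.rank g = (R.N g).encard :=
  height_set_eq_encard (R.N g)

end SignedSets

/-! ### The abstract root system of a Coxeter system -/

namespace CoxeterSystem

universe u v

variable {B : Type v} {M : CoxeterMatrix B} {W : Type u} [Group W] (cs : CoxeterSystem M W)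

open Classical in
/-- The map `(t, ε) ↦ (s t s, ± ε)` on `T × {±}` attached to a simple reflection `s`, where `T` is
the set of reflections and the sign is `-` if and only if `t = s`. -/
noncomputable def rootStep (i : B) (x : {t : W // cs.IsReflection t} × ℤˣ) :
    {t : W // cs.IsReflection t} × ℤˣ :=
  (⟨cs.simple i * x.1 * (cs.simple i)⁻¹, x.1.2.conj _⟩,
    (if (x.1 : W) = cs.simple i then -1 else 1) * x.2)

theorem rootStep_rootStep (i : B) (x : {t : W // cs.IsReflection t} × ℤˣ) :
    cs.rootStep i (cs.rootStep i x) = x := by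
  classical
  obtain ⟨⟨t, ht⟩, e⟩ := x
  have h : cs.simple i * t * (cs.simple i)⁻¹ = cs.simple i ↔ t = cs.simple i := by
    rw [mul_inv_eq_iff_eq_mul, mul_right_inj]
  refine Prod.ext (Subtype.ext ?_) ?_
  · simp [rootStep, mul_assoc]
  · show (if cs.simple i * t * (cs.simple i)⁻¹ = cs.simple i then (-1 : ℤˣ) else 1) *
      ((if t = cs.simple i then -1 else 1) * e) = e
    by_cases ht' : t = cs.simple i
    · rw [if_pos ht', if_pos (h.2 ht')]; simp
    · rw [if_neg ht', if_neg (fun h' => ht' (h.1 h'))]; simp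

/-- The involution `rootStep` as a permutation. -/
noncomputable def rootPerm (i : B) : Equiv.Perm ({t : W // cs.IsReflection t} × ℤˣ) where
  toFun := cs.rootStep i
  invFun := cs.rootStep i
  left_inv := cs.rootStep_rootStep i
  right_inv := cs.rootStep_rootStep i

theorem rootPerm_isLiftable : M.IsLiftable cs.rootPerm := by
  classical
  intro i j
  set p : W := cs.simple i * cs.simple j with hp
  have hpinv : p⁻¹ = cs.simple j * cs.simple i := by simp [hp]
  have hr : ∀ n : ℕ, p⁻¹ * (cs.simple j * p ^ n) * p = cs.simple j * p ^ (n + 2) := by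
    intro n
    have : p⁻¹ * cs.simple j = cs.simple j * p := by rw [hpinv, hp, mul_assoc]
    calc p⁻¹ * (cs.simple j * p ^ n) * p = (p⁻¹ * cs.simple j) * p ^ n * p := by group
      _ = cs.simple j * p ^ (n + 2) := by rw [this]; group
  have hstep : ∀ x : {t : W // cs.IsReflection t} × ℤˣ,
      (((cs.rootPerm i * cs.rootPerm j) x).1 : W) = p * x.1 * p⁻¹ ∧
      ((cs.rootPerm i * cs.rootPerm j) x).2 =
        ((if (x.1 : W) = cs.simple j * p ^ 0 then -1 else 1) *
          (if (x.1 : W) = cs.simple j * p ^ 1 then -1 else 1)) * x.2 := by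
    rintro ⟨⟨t, ht⟩, e⟩
    have h1 : cs.simple j * t * (cs.simple j)⁻¹ = cs.simple i ↔ t = cs.simple j * p ^ 1 := by
      rw [mul_inv_eq_iff_eq_mul, pow_one, ← hp, ← eq_inv_mul_iff_mul_eq, cs.inv_simple]
    constructor
    · simp [rootPerm, rootStep, hp, mul_assoc]
    · simp only [rootPerm, rootStep, Equiv.Perm.coe_mul, Function.comp_apply, Equiv.coe_fn_mk, h1,
        pow_zero, mul_one]
      rw [← mul_assoc]
      congr 1
      rw [mul_comm]
  have hpow : ∀ (k : ℕ) (x : {t : W // cs.IsReflection t} × ℤˣ),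
      ((((cs.rootPerm i * cs.rootPerm j) ^ k) x).1 : W) = p ^ k * x.1 * (p ^ k)⁻¹ ∧
      (((cs.rootPerm i * cs.rootPerm j) ^ k) x).2 =
        (∏ n ∈ Finset.range (2 * k),
          (if (x.1 : W) = cs.simple j * p ^ n then (-1 : ℤˣ) else 1)) * x.2 := by
    intro k
    induction k with
    | zero => intro x; simp
    | succ k ih =>
      intro x
      obtain ⟨a1, a2⟩ := hstep x
      obtain ⟨b1, b2⟩ := ih ((cs.rootPerm i * cs.rootPerm j) x)
      rw [pow_succ, Equiv.Perm.mul_apply]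
      constructor
      · rw [b1, a1]
        group
      · have hiff : ∀ n : ℕ, p * (x.1 : W) * p⁻¹ = cs.simple j * p ^ n ↔
            (x.1 : W) = cs.simple j * p ^ (n + 2) := by
          intro n
          rw [← hr n, mul_inv_eq_iff_eq_mul, ← eq_inv_mul_iff_mul_eq, mul_assoc p⁻¹]
        rw [b2, a2, a1]
        simp only [hiff]
        rw [show 2 * (k + 1) = 2 * k + 2 by ring, Finset.prod_range_succ', Finset.prod_range_succ']
        simp only [Nat.zero_add, Nat.add_assoc, Nat.reduceAdd]
        rw [← mul_assoc]
        congr 1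
        rw [mul_assoc]
        congr 1
        rw [mul_comm]
  have hm : p ^ M i j = 1 := cs.simple_mul_simple_pow i j
  ext1 x
  obtain ⟨c1, c2⟩ := hpow (M i j) x
  refine Prod.ext (Subtype.ext ?_) ?_
  · rw [c1, hm]; simp
  · rw [c2, two_mul, Finset.prod_range_add]
    simp only [pow_add, hm, one_mul]
    rw [Int.units_mul_self, one_mul]
    rfl

/-- The action of `W` on `T × {±}`, determined by `s (t, ε) = (s t s, ± ε)` for `s` simple. -/
noncomputable def rootAction : W →* Equiv.Perm ({t : W // cs.IsReflection t} × ℤˣ) :=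
  cs.lift ⟨cs.rootPerm, cs.rootPerm_isLiftable⟩

theorem rootAction_simple (i : B) (x : {t : W // cs.IsReflection t} × ℤˣ) :
    cs.rootAction (cs.simple i) x = cs.rootStep i x := by
  rw [rootAction, lift_apply_simple]
  rfl

theorem rootAction_neg (w : W) (x : {t : W // cs.IsReflection t} × ℤˣ) :
    cs.rootAction w (x.1, -x.2) = ((cs.rootAction w x).1, -(cs.rootAction w x).2) := by
  revert x
  refine cs.simple_induction_left (p := fun w => ∀ x, cs.rootAction w (x.1, -x.2) =
    ((cs.rootAction w x).1, -(cs.rootAction w x).2)) w (fun x => ?_) (fun w i ih x => ?_)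
  · simp
  · rw [map_mul, Equiv.Perm.mul_apply, Equiv.Perm.mul_apply, ih, rootAction_simple,
      rootAction_simple]
    simp [rootStep]

/-- The abstract root system `Φ = T × {±}` of a Coxeter system as a signed `W`-set, with the set
`T × {+}` of positive elements. -/
noncomputable def abstractRootSystem : SignedGSet W where
  carrier := {t : W // cs.IsReflection t} × ℤˣ
  action := MulAction.compHom _ cs.rootAction
  neg x := (x.1, -x.2)
  neg_neg x := by simp
  smul_neg w x := cs.rootAction_neg w x
  pos := {x | x.2 = 1}
  neg_mem_pos x := by
    rcases Int.units_eq_one_or x.2 with h | h <;> simp [h]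

/-- The half-spaces `W_(t, +) = {w | l(t w) > l(w)}` and `W_(t, -) = {w | l(t w) < l(w)}`. -/
def rootHalfSpace (x : {t : W // cs.IsReflection t} × ℤˣ) : Set W :=
  {w | (x.2 = 1 ∧ cs.length w < cs.length (x.1 * w)) ∨
    (x.2 = -1 ∧ cs.length (x.1 * w) < cs.length w)}

/-- The positive root `(s, +)` of a simple reflection `s`. -/
def simpleRoot (i : B) : {t : W // cs.IsReflection t} × ℤˣ :=
  (⟨cs.simple i, cs.isReflection_simple i⟩, 1)

end CoxeterSystem

/-!
Everything is read off the sets `N w` of left inversions. By strong exchange they form a cocycle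
with values in the sets of reflections, and `|N w|` is the length of `w`; hence
`|N x ∆ N y| = l (x⁻¹ y)`, so inclusion and orthogonality of inversion sets are conditions on
lengths. The elements `d s_i`, `i ∈ J`, that cover `d` have, once they are bounded, the join `d v`
with `v` the longest element of the parabolic subgroup `W_J`. Newman's lemma turns these local joins
into greatest elements of bounded sets, which gives the meets and shows that the descents of a join
are descents of the joined elements; join orthogonality then follows by induction on the length.

Each half-space is `{w | l (t w) > l (w)}` or `{w | l (t w) < l (w)}` for a unique reflection `t`.
It separates `1` from `g` exactly when `t ∈ N g`, so both protorootoids of half-spaces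
are pullbacks of the one given by left inversions.
-/

section General

universe u

open Relation in
/-- Newman's lemma. -/
theorem exists_forall_reflTransGen_of_locallyConfluent {α : Type*} {r : α → α → Prop}
    (hwf : WellFounded (Function.swap r))
    (hr : ∀ a b c, r a b → r a c → Join (ReflTransGen r) b c) (a : α) :
    ∃ g, ∀ x, ReflTransGen r a x → ReflTransGen r x g := by
  induction a using hwf.induction with | h a ih
  by_cases h : ∃ b, r a b
  · obtain ⟨b, hab⟩ := h
    obtain ⟨g, hg⟩ := ih b hab
    refine ⟨g, fun x hax => ?_⟩
    rcases hax.cases_head with rfl | ⟨c, hac, hcx⟩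
    · exact (hg b .refl).head hab
    · obtain ⟨z, hbz, hcz⟩ := hr a b c hab hac
      obtain ⟨g', hg'⟩ := ih c hac
      exact (hg' x hcx).trans (hg g' (hbz.trans (hg' z hcz)))
  · refine ⟨a, fun x hax => ?_⟩
    rcases hax.cases_head with rfl | ⟨c, hac, -⟩
    · exact .refl
    · exact absurd ⟨c, hac⟩ h

theorem ncard_symmDiff_add_two_mul_ncard_inter {α : Type*} {A B : Set α} (hA : A.Finite)
    (hB : B.Finite) : (symmDiff A B).ncard + 2 * (A ∩ B).ncard = A.ncard + B.ncard := by
  have hA' := Set.ncard_sdiff_add_ncard_of_subset (Set.inter_subset_left (s := A) (t := B)) hA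
  have hB' := Set.ncard_sdiff_add_ncard_of_subset (Set.inter_subset_right (s := A) (t := B)) hB
  have h := Set.ncard_union_eq (disjoint_sdiff_sdiff (x := A) (y := B)) hA.sdiff hB.sdiff
  rw [Set.sdiff_inter_self_eq_sdiff, Set.sdiff_self_inter] at *
  rw [Set.symmDiff_def]
  omega

namespace Protorootoid

variable {G : Type u} [Group G] {R R' : Protorootoid G}

theorem WeakLE.refl (x : G) : R.WeakLE x x := le_refl (R.N x)

theorem WeakLE.trans {x y z : G} (hxy : R.WeakLE x y) (hyz : R.WeakLE y z) : R.WeakLE x z :=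
  le_trans (α := R.Λ) hxy hyz

theorem IsRootoid.of_injective (hR : R.IsRootoid) (φ : InfHom R.Λ R'.Λ)
    (hφ : Function.Injective φ) (hbot : φ ⊥ = ⊥) (hN : ∀ g, R'.N g = φ (R.N g)) :
    R'.IsRootoid := by
  have hle : R'.WeakLE = R.WeakLE := by
    ext x y
    rw [WeakLE, WeakLE, hN, hN, ← inf_eq_left, ← map_inf, hφ.eq_iff, inf_eq_left]
  have horth (x y : G) : R'.N x ⊓ R'.N y = ⊥ ↔ R.N x ⊓ R.N y = ⊥ := by
    rw [hN, hN, ← map_inf, ← hbot, hφ.eq_iff]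
  refine ⟨fun g hg => hR.faithful g (hφ ?_), fun A hA => ?_, fun A m y hm hA => ?_⟩
  · rw [← hN, hg, hbot]
  · simpa only [IsMeet, hle] using hR.exists_meet A hA
  · simp only [IsJoin, hle, horth] at hm hA ⊢
    exact hR.join_orthogonality A m y hm hA

end Protorootoid

theorem SetProtorootoid.isRootoid_of_surjective {G : Type u} [Group G] {R R' : SetProtorootoid G}
    (hR : R.toProtorootoid.IsRootoid) {q : R'.Ψ → R.Ψ} (hq : Function.Surjective q)
    (hN : ∀ g, R'.N g = q ⁻¹' R.N g) : R'.toProtorootoid.IsRootoid :=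
  hR.of_injective ⟨(q ⁻¹' ·), fun _ _ => rfl⟩ hq.preimage_injective rfl hN

theorem SetProtorootoid.rank_eq_encard_of_bijective {G : Type u} [Group G] {R : SetProtorootoid G}
    {α : Type*} {q : R.Ψ → α} (hq : Function.Bijective q) {g : G} {A : Set α}
    (hN : R.N g = q ⁻¹' A) : R.toProtorootoid.rank g = A.encard := by
  rw [rank_eq_encard, hN, Set.encard_preimage_of_bijective hq]

open scoped Pointwise in
theorem one_mem_inv_smul_set_iff {G : Type*} [Group G] {g : G} {A : Set G} :
    1 ∈ g⁻¹ • A ↔ g ∈ A := by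
  rw [Set.mem_inv_smul_set_iff, smul_eq_mul, mul_one]

theorem mem_setProtorootoidOf_N_iff {G : Type*} [Group G] {S : Set G} {g : G} {A : halfSpaces S} :
    A ∈ (setProtorootoidOf S).N g ↔ Xor (1 ∈ (A : Set G)) (g ∈ (A : Set G)) := by
  rw [← one_mem_inv_smul_set_iff (g := g)]
  refine Set.mem_symmDiff.trans ?_
  rw [Set.mem_smul_set_iff_inv_smul_mem]
  rfl

theorem IsEvenC0System.mk_mem_N_iff {G : Type*} [Group G] {S : Set G} (hS : IsEvenC0System S)
    {g : G} {A : halfSpaces S} :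
    Quotient.mk hS.signedHalfSpaces.signSetoid A ∈
      hS.signedHalfSpaces.toSetProtorootoid.N g ↔ Xor (1 ∈ (A : Set G)) (g ∈ (A : Set G)) := by
  rw [← one_mem_inv_smul_set_iff (g := g)]
  exact hS.signedHalfSpaces.mk_mem_iff g A

end General

namespace CoxeterRootoid

open CoxeterSystem
open scoped Pointwise

universe u v

variable {B : Type v} {M : CoxeterMatrix B} {W : Type u} [Group W]

/-- The set `T` of reflections of a Coxeter system, as a type. -/
abbrev Reflection (cs : CoxeterSystem M W) : Type u := {t : W // cs.IsReflection t}

/-- `W` acts on `T` by conjugation. -/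
instance (cs : CoxeterSystem M W) : MulAction W (Reflection cs) where
  smul w t := ⟨w * t * w⁻¹, t.2.conj w⟩
  one_smul t := by
    ext1
    change 1 * (t : W) * 1⁻¹ = t
    group
  mul_smul v w t := by
    ext1
    change v * w * (t : W) * (v * w)⁻¹ = v * (w * t * w⁻¹) * v⁻¹
    group

variable (cs : CoxeterSystem M W)

/-- The simple reflection `s_i`, as an element of `T`. -/
def simpleReflection (i : B) : Reflection cs := ⟨cs.simple i, cs.isReflection_simple i⟩

local notation "ℓ" => cs.length

theorem rootAction_fst (w : W) (x : Reflection cs × ℤˣ) : (cs.rootAction w x).1 = w • x.1 := by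
  induction w using cs.simple_induction_left generalizing x with
  | one => simp
  | mul_simple_left w i ih =>
    rw [map_mul, Equiv.Perm.mul_apply, rootAction_simple, mul_smul, ← ih]
    rfl

theorem rootAction_simpleRoot (i : B) :
    cs.rootAction (cs.simple i) (cs.simpleRoot i) = (simpleReflection cs i, -1) := by
  rw [rootAction_simple]
  ext1
  · exact Subtype.ext (mul_inv_cancel_right _ _)
  · simp [rootStep, simpleRoot]

theorem exists_rootAction_simpleRoot (x : Reflection cs × ℤˣ) :
    ∃ w i, cs.rootAction w (cs.simpleRoot i) = x := by
  obtain ⟨⟨_, w, i, rfl⟩, e⟩ := x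
  have hfst := rootAction_fst cs w (cs.simpleRoot i)
  by_cases he : (cs.rootAction w (cs.simpleRoot i)).2 = e
  · exact ⟨w, i, Prod.ext hfst he⟩
  · refine ⟨w * cs.simple i, i, ?_⟩
    rw [map_mul, Equiv.Perm.mul_apply, rootAction_simpleRoot]
    refine (cs.rootAction_neg w (cs.simpleRoot i)).trans (Prod.ext hfst ?_)
    exact (Int.units_ne_iff_eq_neg.1 (Ne.symm he)).symm

theorem rootAction_self (x : Reflection cs × ℤˣ) : cs.rootAction x.1 x = (x.1, -x.2) := by
  obtain ⟨w, i, rfl⟩ := exists_rootAction_simpleRoot cs x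
  have hconj : ((cs.rootAction w (cs.simpleRoot i)).1 : W) = w * cs.simple i * w⁻¹ := by
    rw [rootAction_fst]
    rfl
  rw [hconj, ← Equiv.Perm.mul_apply, ← map_mul, inv_mul_cancel_right, map_mul,
    Equiv.Perm.mul_apply, rootAction_simpleRoot]
  exact cs.rootAction_neg w (cs.simpleRoot i)

theorem mem_leftInvSeq_of_rootAction_snd_ne (ω : List B) (x : Reflection cs × ℤˣ)
    (h : (cs.rootAction (cs.wordProd ω)⁻¹ x).2 ≠ x.2) : (x.1 : W) ∈ cs.leftInvSeq ω := by
  induction ω generalizing x with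
  | nil => simp at h
  | cons i ω ih =>
    rw [wordProd_cons, mul_inv_rev, inv_simple, map_mul, Equiv.Perm.mul_apply,
      rootAction_simple] at h
    rw [leftInvSeq, List.mem_cons, List.mem_map]
    by_cases hx : (x.1 : W) = cs.simple i
    · exact Or.inl hx
    · refine Or.inr ⟨_, ih (cs.rootStep i x) (by simpa [rootStep, hx] using h), ?_⟩
      simp [rootStep, mul_assoc]

theorem isLeftInversion_of_rootAction_snd_ne {w : W} {x : Reflection cs × ℤˣ}
    (h : (cs.rootAction w⁻¹ x).2 ≠ x.2) : cs.IsLeftInversion w x.1 := by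
  obtain ⟨ω, hω, rfl⟩ := cs.exists_isReduced w
  exact cs.isLeftInversion_of_mem_leftInvSeq hω (mem_leftInvSeq_of_rootAction_snd_ne cs ω x h)

theorem isLeftInversion_iff_rootAction_snd_ne (w : W) (x : Reflection cs × ℤˣ) :
    cs.IsLeftInversion w x.1 ↔ (cs.rootAction w⁻¹ x).2 ≠ x.2 := by
  refine ⟨fun h heq => ?_, isLeftInversion_of_rootAction_snd_ne cs⟩
  -- If `w⁻¹` fixed the sign of `x`, then `(t w)⁻¹ = w⁻¹ t` would change it, where `t = x.1`.
  have hne : (cs.rootAction (x.1 * w)⁻¹ x).2 ≠ x.2 := by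
    rw [mul_inv_rev, x.1.2.inv, map_mul, Equiv.Perm.mul_apply, rootAction_self,
      rootAction_neg, heq]
    exact fun h => units_ne_neg_self x.2 h.symm
  exact x.1.2.isLeftInversion_mul_right_iff.1 (isLeftInversion_of_rootAction_snd_ne cs hne) h

/-- The set `N w` of left inversions of `w`, as a subset of `T`. -/
def leftInversions (w : W) : Set (Reflection cs) := {t | cs.IsLeftInversion w t}

local notation "𝒩" => leftInversions cs

theorem mem_leftInversions_iff (w : W) (t : Reflection cs) (e : ℤˣ) :
    t ∈ 𝒩 w ↔ (cs.rootAction w⁻¹ (t, e)).2 ≠ e :=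
  isLeftInversion_iff_rootAction_snd_ne cs w (t, e)

theorem leftInversions_mul (x y : W) : 𝒩 (x * y) = symmDiff (𝒩 x) (x • 𝒩 y) := by
  have sign_ne_iff : ∀ a b c : ℤˣ, c ≠ a ↔ Xor (b ≠ a) (c ≠ b) := by decide
  ext t
  rw [Set.mem_symmDiff, Set.mem_smul_set_iff_inv_smul_mem, mem_leftInversions_iff cs _ _ 1,
    mem_leftInversions_iff cs _ _ 1, mul_inv_rev, map_mul, Equiv.Perm.mul_apply,
    mem_leftInversions_iff cs y _ (cs.rootAction x⁻¹ (t, 1)).2, ← rootAction_fst cs x⁻¹ (t, 1)]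
  exact sign_ne_iff _ _ _

theorem mem_leftInvSeq_iff {ω : List B} (hω : cs.IsReduced ω) {t : Reflection cs} :
    (t : W) ∈ cs.leftInvSeq ω ↔ t ∈ 𝒩 (cs.wordProd ω) :=
  ⟨cs.isLeftInversion_of_mem_leftInvSeq hω, fun h =>
    mem_leftInvSeq_of_rootAction_snd_ne cs ω (t, 1) ((mem_leftInversions_iff cs _ t 1).1 h)⟩

theorem exists_mul_wordProd_eq_eraseIdx {ω : List B} (hω : cs.IsReduced ω) {t : Reflection cs}
    (ht : t ∈ 𝒩 (cs.wordProd ω)) :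
    ∃ j < ω.length, t * cs.wordProd ω = cs.wordProd (ω.eraseIdx j) := by
  obtain ⟨j, hj, hjt⟩ := List.mem_iff_getElem.1 ((mem_leftInvSeq_iff cs hω).2 ht)
  refine ⟨j, by simpa using hj, ?_⟩
  rw [← hjt, ← List.getD_eq_getElem _ 1 hj, getD_leftInvSeq_mul_wordProd]

theorem encard_leftInversions (w : W) : (𝒩 w).encard = ℓ w := by
  classical
  obtain ⟨ω, hω, rfl⟩ := cs.exists_isReduced w
  have himage : Subtype.val '' 𝒩 (cs.wordProd ω) = ((cs.leftInvSeq ω).toFinset : Set W) := by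
    ext t
    rw [List.coe_toFinset]
    refine ⟨?_, fun ht => ?_⟩
    · rintro ⟨t, ht, rfl⟩
      exact (mem_leftInvSeq_iff cs hω).2 ht
    · have hinv := cs.isLeftInversion_of_mem_leftInvSeq hω ht
      exact ⟨⟨t, hinv.1⟩, hinv, rfl⟩
  rw [← Subtype.val_injective.encard_image, himage, Set.encard_coe_eq_coe_finsetCard,
    List.toFinset_card_of_nodup hω.nodup_leftInvSeq, length_leftInvSeq, hω.eq]

theorem finite_leftInversions (w : W) : (𝒩 w).Finite := by
  rw [← Set.encard_ne_top_iff, encard_leftInversions]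
  exact ENat.natCast_ne_top _

theorem ncard_leftInversions (w : W) : (𝒩 w).ncard = ℓ w := by
  rw [Set.ncard, encard_leftInversions, ENat.toNat_natCast]

theorem leftInversions_eq_empty_iff {w : W} : 𝒩 w = ∅ ↔ w = 1 := by
  rw [← Set.encard_eq_zero, encard_leftInversions, Nat.cast_eq_zero, length_eq_zero_iff]

theorem ncard_symmDiff_leftInversions (x y : W) : (symmDiff (𝒩 x) (𝒩 y)).ncard = ℓ (x⁻¹ * y) := by
  rw [← mul_inv_cancel_left x y, leftInversions_mul, symmDiff_symmDiff_cancel_left,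
    Set.ncard_smul_set, ncard_leftInversions, inv_mul_cancel_left]

theorem length_inv_mul_add (x y : W) : ℓ (x⁻¹ * y) + 2 * (𝒩 x ∩ 𝒩 y).ncard = ℓ x + ℓ y := by
  rw [← ncard_symmDiff_leftInversions, ncard_symmDiff_add_two_mul_ncard_inter
    (finite_leftInversions cs x) (finite_leftInversions cs y), ncard_leftInversions,
    ncard_leftInversions]

theorem leftInversions_subset_iff {x y : W} : 𝒩 x ⊆ 𝒩 y ↔ ℓ x + ℓ (x⁻¹ * y) = ℓ y := by
  have hlen := length_inv_mul_add cs x y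
  rw [← Set.inter_eq_left]
  constructor
  · intro h
    rw [h, ncard_leftInversions] at hlen
    omega
  · intro h
    refine Set.eq_of_subset_of_ncard_le Set.inter_subset_left ?_ (finite_leftInversions cs x)
    rw [ncard_leftInversions]
    omega

theorem disjoint_leftInversions_iff {x y : W} :
    Disjoint (𝒩 x) (𝒩 y) ↔ ℓ (x⁻¹ * y) = ℓ x + ℓ y := by
  rw [Set.disjoint_iff_inter_eq_empty,
    ← Set.ncard_eq_zero ((finite_leftInversions cs x).inter_of_left _), ← length_inv_mul_add]
  omega

theorem simpleReflection_mem_leftInversions_iff {w : W} {i : B} :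
    simpleReflection cs i ∈ 𝒩 w ↔ cs.IsLeftDescent w i :=
  cs.isLeftInversion_simple_iff_isLeftDescent w i

theorem leftInversions_simple (i : B) : 𝒩 (cs.simple i) = {simpleReflection cs i} := by
  have hred : cs.IsReduced [i] := by simp [CoxeterSystem.IsReduced]
  ext t
  simpa [Subtype.ext_iff, simpleReflection] using (mem_leftInvSeq_iff cs hred (t := t)).symm

/-- The protorootoid `(W, ℘(T), N)` given by the left inversion sets. -/
def inversionProtorootoid : Protorootoid W :=
  SetProtorootoid.toProtorootoid
    { Ψ := Reflection cs
      N := leftInversions cs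
      N_mul := leftInversions_mul cs }

local infix:50 " ≼ " => Protorootoid.WeakLE (inversionProtorootoid cs)

theorem weakLE_iff_subset {x y : W} : x ≼ y ↔ 𝒩 x ⊆ 𝒩 y := Iff.rfl

theorem weakLE_iff_length {x y : W} : x ≼ y ↔ ℓ x + ℓ (x⁻¹ * y) = ℓ y :=
  leftInversions_subset_iff cs

variable {cs}

theorem one_weakLE (x : W) : 1 ≼ x := by
  rw [weakLE_iff_subset, (leftInversions_eq_empty_iff cs).2 rfl]
  exact Set.empty_subset _

theorem length_le_of_weakLE {x y : W} (h : x ≼ y) : ℓ x ≤ ℓ y := by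
  rw [weakLE_iff_length] at h
  omega

theorem simple_weakLE_iff {i : B} {u : W} : cs.simple i ≼ u ↔ cs.IsLeftDescent u i := by
  rw [weakLE_iff_subset, leftInversions_simple, Set.singleton_subset_iff,
    simpleReflection_mem_leftInversions_iff]

theorem isLeftDescent_mono {x y : W} {i : B} (hxy : x ≼ y) (hx : cs.IsLeftDescent x i) :
    cs.IsLeftDescent y i :=
  simple_weakLE_iff.1 ((simple_weakLE_iff.2 hx).trans hxy)

theorem weakLE_mul_iff {d v : W} : d ≼ d * v ↔ ℓ (d * v) = ℓ d + ℓ v := by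
  rw [weakLE_iff_length, inv_mul_cancel_left, eq_comm]

theorem weakLE_inv_mul_iff {d a v : W} (hda : d ≼ a) :
    v ≼ d⁻¹ * a ↔ d ≼ d * v ∧ d * v ≼ a := by
  have hdv := cs.length_mul_le d v
  have hva := cs.length_mul_le (d * v) ((d * v)⁻¹ * a)
  rw [mul_inv_cancel_left] at hva
  rw [weakLE_iff_length] at hda
  rw [weakLE_mul_iff, weakLE_iff_length, weakLE_iff_length, ← mul_assoc, ← mul_inv_rev]
  omega

theorem exists_mul_simple_weakLE {x y : W} (hxy : x ≼ y) (hne : x ≠ y) :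
    ∃ i, x ≼ x * cs.simple i ∧ x * cs.simple i ≼ y := by
  obtain ⟨i, hi⟩ := cs.exists_leftDescent_of_ne_one fun h => hne (inv_mul_eq_one.1 h)
  exact ⟨i, (weakLE_inv_mul_iff hxy).1 (simple_weakLE_iff.2 hi)⟩

theorem simple_mul_weakLE {x u : W} {i : B} (hxu : x ≼ u) (hx : ¬ cs.IsLeftDescent x i)
    (hu : cs.IsLeftDescent u i) : cs.simple i * x ≼ u := by
  have hmem : x⁻¹ • simpleReflection cs i ∈ 𝒩 (x⁻¹ * u) := by
    rw [← simpleReflection_mem_leftInversions_iff, ← mul_inv_cancel_left x u, leftInversions_mul,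
      Set.mem_symmDiff, Set.mem_smul_set_iff_inv_smul_mem] at hu
    rw [← simpleReflection_mem_leftInversions_iff] at hx
    tauto
  have hlt : ℓ ((cs.simple i * x)⁻¹ * u) < ℓ (x⁻¹ * u) := by
    have heq : (x⁻¹ * cs.simple i * x⁻¹⁻¹) * (x⁻¹ * u) = (cs.simple i * x)⁻¹ * u := by
      rw [mul_inv_rev, inv_simple]
      group
    exact heq ▸ hmem.2
  have hle := cs.length_mul_le (cs.simple i * x) ((cs.simple i * x)⁻¹ * u)
  rw [mul_inv_cancel_left] at hle
  rw [not_isLeftDescent_iff] at hx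
  rw [weakLE_iff_length] at hxu ⊢
  omega

/-! ### Parabolic subgroups and joins of covers -/

variable (cs) in
/-- The standard parabolic subgroup `W_J`. -/
def parabolic (J : Set B) : Subgroup W := Subgroup.closure (cs.simple '' J)

variable {J : Set B}

theorem simple_mem_parabolic {i : B} (hi : i ∈ J) : cs.simple i ∈ parabolic cs J :=
  Subgroup.subset_closure ⟨i, hi, rfl⟩

theorem wordProd_mem_parabolic {ω : List B} (hω : ∀ i ∈ ω, i ∈ J) :
    cs.wordProd ω ∈ parabolic cs J := by
  refine list_prod_mem fun x hx => ?_
  obtain ⟨i, hi, rfl⟩ := List.mem_map.1 hx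
  exact simple_mem_parabolic (hω i hi)

theorem exists_isReduced_simple_mul {ω : List B} (hred : cs.IsReduced ω) (hω : ∀ i ∈ ω, i ∈ J)
    {i : B} (hi : i ∈ J) :
    ∃ ω', (∀ k ∈ ω', k ∈ J) ∧ cs.IsReduced ω' ∧ cs.wordProd ω' = cs.simple i * cs.wordProd ω := by
  by_cases h : cs.IsLeftDescent (cs.wordProd ω) i
  · obtain ⟨j, hj, he⟩ := exists_mul_wordProd_eq_eraseIdx cs hred
      ((simpleReflection_mem_leftInversions_iff cs).2 h)
    refine ⟨ω.eraseIdx j, fun k hk => hω k (List.mem_of_mem_eraseIdx hk), ?_, he.symm⟩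
    rw [isLeftDescent_iff, hred.eq, show cs.simple i * _ = _ from he] at h
    rw [CoxeterSystem.IsReduced, List.length_eraseIdx_of_lt hj]
    omega
  · refine ⟨i :: ω, List.forall_mem_cons.2 ⟨hi, hω⟩, ?_, cs.wordProd_cons i ω⟩
    rw [not_isLeftDescent_iff, hred.eq] at h
    rw [CoxeterSystem.IsReduced, wordProd_cons, h, List.length_cons]

theorem exists_isReduced_of_mem_parabolic {x : W} (hx : x ∈ parabolic cs J) :
    ∃ ω, (∀ i ∈ ω, i ∈ J) ∧ cs.IsReduced ω ∧ cs.wordProd ω = x := by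
  induction hx using Subgroup.closure_induction_left with
  | one => exact ⟨[], by simp, by simp [CoxeterSystem.IsReduced], cs.wordProd_nil⟩
  | mul_left _ hi _ _ ih =>
    obtain ⟨i, hi, rfl⟩ := hi
    obtain ⟨ω, hω, hred, rfl⟩ := ih
    exact exists_isReduced_simple_mul hred hω hi
  | inv_mul_cancel _ hi _ _ ih =>
    obtain ⟨i, hi, rfl⟩ := hi
    obtain ⟨ω, hω, hred, rfl⟩ := ih
    rw [inv_simple]
    exact exists_isReduced_simple_mul hred hω hi

theorem mem_parabolic_of_mem_leftInversions {v : W} (hv : v ∈ parabolic cs J) {t : Reflection cs}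
    (ht : t ∈ leftInversions cs v) : (t : W) ∈ parabolic cs J := by
  obtain ⟨ω, hω, hred, rfl⟩ := exists_isReduced_of_mem_parabolic hv
  obtain ⟨j, -, he⟩ := exists_mul_wordProd_eq_eraseIdx cs hred ht
  rw [← Subgroup.mul_mem_cancel_right _ hv, he]
  exact wordProd_mem_parabolic fun i hi => hω i (List.mem_of_mem_eraseIdx hi)

theorem exists_eq_simple_of_mem_parabolic {x : W} (hx : x ∈ parabolic cs J) (hlen : ℓ x = 1) :
    ∃ i ∈ J, x = cs.simple i := by
  obtain ⟨ω, hω, hred, rfl⟩ := exists_isReduced_of_mem_parabolic hx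
  rw [hred.eq] at hlen
  obtain ⟨i, rfl⟩ := List.length_eq_one_iff.1 hlen
  exact ⟨i, hω i (List.mem_singleton_self i), cs.wordProd_singleton i⟩

theorem weakLE_of_mem_parabolic {x u : W} (hx : x ∈ parabolic cs J)
    (hu : ∀ i ∈ J, cs.IsLeftDescent u i) : x ≼ u := by
  obtain ⟨ω, hω, hred, rfl⟩ := exists_isReduced_of_mem_parabolic hx
  induction ω with
  | nil => exact cs.wordProd_nil ▸ one_weakLE u
  | cons i ω ih =>
    obtain ⟨hi, hω⟩ := List.forall_mem_cons.1 hω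
    have hred' : cs.IsReduced ω := by simpa using hred.drop 1
    have hdesc : ¬ cs.IsLeftDescent (cs.wordProd ω) i := by
      rw [not_isLeftDescent_iff, ← wordProd_cons, hred.eq, hred'.eq, List.length_cons]
    rw [wordProd_cons]
    exact simple_mul_weakLE (ih hω hred' (wordProd_mem_parabolic hω)) hdesc (hu i hi)

/-- The element `v` is the longest element of `W_J`. -/
theorem exists_mem_parabolic_forall_isLeftDescent {u : W} (hu : ∀ i ∈ J, cs.IsLeftDescent u i) :
    ∃ v ∈ parabolic cs J, ∀ i ∈ J, cs.IsLeftDescent v i := by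
  have hbdd : BddAbove (cs.length '' (parabolic cs J : Set W)) := by
    refine ⟨ℓ u, ?_⟩
    rintro _ ⟨x, hx, rfl⟩
    exact length_le_of_weakLE (weakLE_of_mem_parabolic hx hu)
  obtain ⟨v, hv, hmax⟩ := Nat.sSup_mem (Set.Nonempty.image _ ⟨1, one_mem (parabolic cs J)⟩) hbdd
  refine ⟨v, hv, fun i hi => ?_⟩
  have hle : ℓ (cs.simple i * v) ≤ ℓ v :=
    hmax ▸ le_csSup hbdd ⟨_, mul_mem (simple_mem_parabolic hi) hv, rfl⟩
  by_contra h
  rw [not_isLeftDescent_iff] at h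
  omega

theorem isJoin_mul_simple {d v : W} (hJ : J.Nonempty) (hd : ∀ i ∈ J, d ≼ d * cs.simple i)
    (hv : v ∈ parabolic cs J) (hvJ : ∀ i ∈ J, cs.IsLeftDescent v i) (hdv : d ≼ d * v) :
    (inversionProtorootoid cs).IsJoin ((fun i => d * cs.simple i) '' J) (d * v) := by
  refine ⟨?_, fun z hz => ?_⟩
  · rintro _ ⟨i, hi, rfl⟩
    refine ((weakLE_inv_mul_iff hdv).1 (simple_weakLE_iff.2 ?_)).2
    rw [inv_mul_cancel_left]
    exact hvJ i hi
  · have hzJ (i : B) (hi : i ∈ J) : d * cs.simple i ≼ z := hz _ ⟨i, hi, rfl⟩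
    obtain ⟨i₀, hi₀⟩ := hJ
    have hdz : d ≼ z := (hd i₀ hi₀).trans (hzJ i₀ hi₀)
    refine ((weakLE_inv_mul_iff hdz).1 (weakLE_of_mem_parabolic hv fun i hi => ?_)).2
    exact simple_weakLE_iff.1 ((weakLE_inv_mul_iff hdz).2 ⟨hd i hi, hzJ i hi⟩)

theorem exists_isJoin_mul_simple {d a : W} (hJ : J.Nonempty) (hd : ∀ i ∈ J, d ≼ d * cs.simple i)
    (ha : ∀ i ∈ J, d * cs.simple i ≼ a) :
    ∃ v ∈ parabolic cs J, (∀ i ∈ J, cs.IsLeftDescent v i) ∧ d ≼ d * v ∧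
      (inversionProtorootoid cs).IsJoin ((fun i => d * cs.simple i) '' J) (d * v) := by
  have hda : d ≼ a := hJ.elim fun i hi => (hd i hi).trans (ha i hi)
  have hdesc (i : B) (hi : i ∈ J) : cs.IsLeftDescent (d⁻¹ * a) i :=
    simple_weakLE_iff.1 ((weakLE_inv_mul_iff hda).2 ⟨hd i hi, ha i hi⟩)
  obtain ⟨v, hv, hvJ⟩ := exists_mem_parabolic_forall_isLeftDescent hdesc
  have hdv := ((weakLE_inv_mul_iff hda).1 (weakLE_of_mem_parabolic hv hdesc)).1
  exact ⟨v, hv, hvJ, hdv, isJoin_mul_simple hJ hd hv hvJ hdv⟩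

/-- The local case of `not_isLeftDescent_of_isJoin`, in which `d * v` is the join of the covers
`d * s_i` of `d` for `i ∈ J`. -/
theorem not_isLeftDescent_mul {d v : W} {k : B} (hv : v ∈ parabolic cs J)
    (hvJ : ∀ i ∈ J, cs.IsLeftDescent v i) (hdv : d ≼ d * v) (hk : ¬ cs.IsLeftDescent d k)
    (hJ : ∀ i ∈ J, ¬ cs.IsLeftDescent (d * cs.simple i) k) : ¬ cs.IsLeftDescent (d * v) k := by
  intro hdvk
  -- `t = d⁻¹ s_k d` is an inversion of `v`, hence lies in `W_J` and below `v`; then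
  -- `d t = s_k d` is longer than `d` by both `1` and `l t`, so `t` is simple.
  obtain ⟨t, ht⟩ : ∃ t, t = d⁻¹ • simpleReflection cs k := ⟨_, rfl⟩
  have htv : t ∈ 𝒩 v := by
    rw [← simpleReflection_mem_leftInversions_iff] at hk hdvk
    rw [leftInversions_mul, Set.mem_symmDiff, Set.mem_smul_set_iff_inv_smul_mem, ← ht] at hdvk
    tauto
  have hdt : d * t = cs.simple k * d := by
    rw [ht]
    change d * (d⁻¹ * cs.simple k * d⁻¹⁻¹) = _
    group
  have htJ : (t : W) ∈ parabolic cs J := mem_parabolic_of_mem_leftInversions hv htv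
  have htv' : (t : W) ≼ d⁻¹ * (d * v) := by
    rw [inv_mul_cancel_left]
    exact weakLE_of_mem_parabolic htJ hvJ
  have hlen : ℓ (t : W) = 1 := by
    have h := weakLE_mul_iff.1 ((weakLE_inv_mul_iff hdv).1 htv').1
    rw [hdt, cs.not_isLeftDescent_iff.1 hk] at h
    omega
  obtain ⟨i, hi, hti⟩ := exists_eq_simple_of_mem_parabolic htJ hlen
  refine hJ i hi ?_
  rwa [← hti, hdt, isLeftDescent_iff_not_isLeftDescent_mul, simple_mul_simple_cancel_left]

/-! ### Meets and join orthogonality -/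

variable (cs) in
/-- The relation "`y` lies in `P` and covers `x`" for the weak order. -/
def CoversIn (P : Set W) (x y : W) : Prop := y ∈ P ∧ ∃ i, y = x * cs.simple i ∧ x ≼ y

theorem CoversIn.length_eq {P : Set W} {x y : W} (h : CoversIn cs P x y) : ℓ y = ℓ x + 1 := by
  obtain ⟨-, i, rfl, hxy⟩ := h
  rw [weakLE_mul_iff.1 hxy, length_simple]

open Relation in
theorem mem_of_reflTransGen_coversIn {P : Set W} {x y : W} (hx : x ∈ P)
    (h : ReflTransGen (CoversIn cs P) x y) : y ∈ P := by
  rcases h.cases_tail with rfl | ⟨_, -, hy⟩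
  exacts [hx, hy.1]

open Relation in
theorem reflTransGen_coversIn_iff {P : Set W} (hP : ∀ x y, x ≼ y → y ∈ P → x ∈ P) {x y : W}
    (hy : y ∈ P) : ReflTransGen (CoversIn cs P) x y ↔ x ≼ y := by
  constructor
  · intro h
    induction h with
    | refl => exact .refl x
    | tail _ hyz ih =>
      obtain ⟨hz, i, rfl, hle⟩ := hyz
      exact (ih (hP _ _ hle hz)).trans hle
  · intro hxy
    induction hn : ℓ y - ℓ x generalizing x with
    | zero =>
      obtain rfl : x = y := by
        rw [weakLE_iff_length] at hxy
        rw [← inv_mul_eq_one, ← length_eq_zero_iff cs]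
        omega
      exact .refl
    | succ n ih =>
      obtain ⟨i, hxi, hiy⟩ := exists_mul_simple_weakLE hxy (by rintro rfl; omega)
      have hcov : CoversIn cs P x (x * cs.simple i) := ⟨hP _ _ hiy hy, i, rfl, hxi⟩
      exact (ih hiy (by rw [hcov.length_eq]; omega)).head hcov

theorem exists_greatest {P : Set W} {n : ℕ} (h1 : (1 : W) ∈ P)
    (hP : ∀ x y, x ≼ y → y ∈ P → x ∈ P) (hn : ∀ x ∈ P, ℓ x ≤ n)
    (hjoin : ∀ d i j, d ≼ d * cs.simple i → d ≼ d * cs.simple j → d * cs.simple i ∈ P →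
      d * cs.simple j ∈ P → ∃ z ∈ P, d * cs.simple i ≼ z ∧ d * cs.simple j ≼ z) :
    ∃ g ∈ P, ∀ x ∈ P, x ≼ g := by
  have hwf : WellFounded (Function.swap (CoversIn cs P)) := by
    refine Subrelation.wf (fun {y x} hxy => ?_) (measure fun x => n - ℓ x).wf
    have hlen := CoversIn.length_eq hxy
    have hle := hn y hxy.1
    change n - ℓ y < n - ℓ x
    omega
  obtain ⟨g, hg⟩ := exists_forall_reflTransGen_of_locallyConfluent hwf (a := 1) (by
    rintro d _ _ ⟨hi, i, rfl, hdi⟩ ⟨hj, j, rfl, hdj⟩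
    obtain ⟨z, hz, hiz, hjz⟩ := hjoin d i j hdi hdj hi hj
    exact ⟨z, (reflTransGen_coversIn_iff hP hz).2 hiz, (reflTransGen_coversIn_iff hP hz).2 hjz⟩)
  have hgP : g ∈ P := mem_of_reflTransGen_coversIn h1 (hg 1 .refl)
  exact ⟨g, hgP, fun x hx => (reflTransGen_coversIn_iff hP hgP).1
    (hg x ((reflTransGen_coversIn_iff hP hx).2 (one_weakLE x)))⟩

theorem exists_isMeet {A : Set W} (hA : A.Nonempty) :
    ∃ m, (inversionProtorootoid cs).IsMeet A m := by
  obtain ⟨a, ha⟩ := hA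
  refine exists_greatest (P := {z | ∀ x ∈ A, z ≼ x}) (fun x _ => one_weakLE x)
    (fun x y hxy hy b hb => hxy.trans (hy b hb)) (fun x hx => length_le_of_weakLE (hx a ha)) ?_
  intro d i j hdi hdj hi hj
  have hij (b : W) (hb : b ∈ A) : ∀ k ∈ ({i, j} : Set B), d * cs.simple k ≼ b := by
    rintro k (rfl | rfl)
    exacts [hi b hb, hj b hb]
  obtain ⟨v, -, -, -, hjoin⟩ := exists_isJoin_mul_simple (Set.insert_nonempty i {j})
    (by rintro k (rfl | rfl) <;> assumption) (hij a ha)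
  exact ⟨d * v, fun b hb => hjoin.2 b (Set.forall_mem_image.2 (hij b hb)),
    hjoin.1 _ ⟨i, by simp, rfl⟩, hjoin.1 _ ⟨j, by simp, rfl⟩⟩

theorem not_isLeftDescent_of_isJoin {A : Set W} {m : W} {k : B}
    (hm : (inversionProtorootoid cs).IsJoin A m) (hA : ∀ x ∈ A, ¬ cs.IsLeftDescent x k) :
    ¬ cs.IsLeftDescent m k := by
  obtain ⟨g, hg, hmax⟩ := exists_greatest (P := {z | z ≼ m ∧ ¬ cs.IsLeftDescent z k})
    ⟨one_weakLE m, cs.not_isLeftDescent_one k⟩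
    (fun x y hxy hy => ⟨hxy.trans hy.1, fun h => hy.2 (isLeftDescent_mono hxy h)⟩)
    (fun x hx => length_le_of_weakLE hx.1) (by
      intro d i j hdi hdj hi hj
      have hij : ∀ l ∈ ({i, j} : Set B), d * cs.simple l ≼ m ∧
          ¬ cs.IsLeftDescent (d * cs.simple l) k := by
        rintro l (rfl | rfl) <;> assumption
      obtain ⟨v, hv, hvJ, hdv, hjoin⟩ := exists_isJoin_mul_simple (Set.insert_nonempty i {j})
        (by rintro l (rfl | rfl) <;> assumption) fun l hl => (hij l hl).1
      have hdk : ¬ cs.IsLeftDescent d k := fun h => hi.2 (isLeftDescent_mono hdi h)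
      exact ⟨d * v, ⟨hjoin.2 m (Set.forall_mem_image.2 fun l hl => (hij l hl).1),
        not_isLeftDescent_mul hv hvJ hdv hdk fun l hl => (hij l hl).2⟩,
        hjoin.1 _ ⟨i, by simp, rfl⟩, hjoin.1 _ ⟨j, by simp, rfl⟩⟩)
  exact fun h => hg.2 (isLeftDescent_mono (hm.2 g fun x hx => hmax x ⟨hm.1 x hx, hA x hx⟩) h)

theorem not_isLeftDescent_simple_mul_iff {x : W} {i : B} :
    ¬ cs.IsLeftDescent (cs.simple i * x) i ↔ cs.IsLeftDescent x i :=
  cs.isLeftDescent_iff_not_isLeftDescent_mul.symm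

theorem simple_mul_weakLE_simple_mul_iff {x z : W} {i : B} (hx : ¬ cs.IsLeftDescent x i)
    (hz : ¬ cs.IsLeftDescent z i) : cs.simple i * x ≼ cs.simple i * z ↔ x ≼ z := by
  rw [not_isLeftDescent_iff] at hx hz
  rw [weakLE_iff_length, weakLE_iff_length, hx, hz,
    show (cs.simple i * x)⁻¹ * (cs.simple i * z) = x⁻¹ * z by group]
  omega

theorem disjoint_leftInversions_simple_mul {x y : W} {i : B} (hx : ¬ cs.IsLeftDescent x i)
    (hy : ¬ cs.IsLeftDescent y i) :
    Disjoint (𝒩 x) (𝒩 (cs.simple i * y)) ↔ Disjoint (𝒩 (cs.simple i * x)) (𝒩 y) := by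
  rw [not_isLeftDescent_iff] at hx hy
  rw [disjoint_leftInversions_iff, disjoint_leftInversions_iff, hx, hy, mul_inv_rev, inv_simple,
    mul_assoc]
  omega

theorem isJoin_simple_mul {A : Set W} {m : W} {i : B} (hne : A.Nonempty)
    (hm : (inversionProtorootoid cs).IsJoin A m) (hA : ∀ x ∈ A, ¬ cs.IsLeftDescent x i) :
    (inversionProtorootoid cs).IsJoin ((cs.simple i * ·) '' A) (cs.simple i * m) := by
  have hmi := not_isLeftDescent_of_isJoin hm hA
  refine ⟨?_, fun b hb => ?_⟩
  · rintro _ ⟨x, hx, rfl⟩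
    exact (simple_mul_weakLE_simple_mul_iff (hA x hx) hmi).2 (hm.1 x hx)
  · obtain ⟨a, ha⟩ := hne
    have hai : cs.IsLeftDescent (cs.simple i * a) i :=
      not_not.1 (not_isLeftDescent_simple_mul_iff.not.2 (hA a ha))
    have hbi := isLeftDescent_mono (hb _ ⟨a, ha, rfl⟩) hai
    obtain ⟨c, rfl⟩ : ∃ c, b = cs.simple i * c := ⟨cs.simple i * b, by simp⟩
    have hci : ¬ cs.IsLeftDescent c i := by
      rwa [← not_isLeftDescent_simple_mul_iff, not_not]
    exact (simple_mul_weakLE_simple_mul_iff hmi hci).2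
      (hm.2 c fun x hx => (simple_mul_weakLE_simple_mul_iff (hA x hx) hci).1 (hb _ ⟨x, hx, rfl⟩))

theorem disjoint_leftInversions_of_isJoin {A : Set W} {m y : W}
    (hm : (inversionProtorootoid cs).IsJoin A m) (hA : ∀ x ∈ A, Disjoint (𝒩 x) (𝒩 y)) :
    Disjoint (𝒩 m) (𝒩 y) := by
  rcases A.eq_empty_or_nonempty with rfl | hne
  · obtain rfl : m = 1 := by
      have := length_le_of_weakLE (hm.2 1 (by simp))
      rwa [length_one, Nat.le_zero, length_eq_zero_iff] at this
    rw [(leftInversions_eq_empty_iff cs).2 rfl]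
    exact Set.empty_disjoint _
  induction hn : ℓ y generalizing y A m with
  | zero =>
    rw [length_eq_zero_iff] at hn
    rw [(leftInversions_eq_empty_iff cs).2 hn]
    exact Set.disjoint_empty _
  | succ n ih =>
    obtain ⟨i, hi⟩ := cs.exists_leftDescent_of_ne_one (w := y) (by rintro rfl; simp at hn)
    have hAi (x : W) (hx : x ∈ A) : ¬ cs.IsLeftDescent x i := fun h =>
      Set.disjoint_left.1 (hA x hx) ((simpleReflection_mem_leftInversions_iff cs).2 h)
        ((simpleReflection_mem_leftInversions_iff cs).2 hi)
    obtain ⟨z, rfl⟩ : ∃ z, y = cs.simple i * z := ⟨cs.simple i * y, by simp⟩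
    have hz : ¬ cs.IsLeftDescent z i := by
      rwa [← not_isLeftDescent_simple_mul_iff, not_not]
    rw [disjoint_leftInversions_simple_mul (not_isLeftDescent_of_isJoin hm hAi) hz]
    refine ih (isJoin_simple_mul hne hm hAi) ?_ (hne.image _) ?_
    · rintro _ ⟨x, hx, rfl⟩
      exact (disjoint_leftInversions_simple_mul (hAi x hx) hz).1 (hA x hx)
    · rw [cs.not_isLeftDescent_iff.1 hz] at hn
      omega

variable (cs) in
theorem isRootoid_inversionProtorootoid : (inversionProtorootoid cs).IsRootoid where
  faithful _ hg := (leftInversions_eq_empty_iff cs).1 hg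
  exists_meet _ hA := exists_isMeet hA
  join_orthogonality _ _ _ hm hA := disjoint_iff.1
    (disjoint_leftInversions_of_isJoin hm fun x hx => disjoint_iff.2 (hA x hx))

/-! ### Half-spaces -/

variable (cs)

theorem wordLength_range_simple (w : W) : wordLength (Set.range cs.simple) w = ℓ w := by
  obtain ⟨ω, hω, rfl⟩ := cs.exists_isReduced w
  have hmem : ω.length ∈ {n | ∃ L : List W, (∀ x ∈ L, x ∈ Set.range cs.simple) ∧
      L.prod = cs.wordProd ω ∧ L.length = n} := ⟨ω.map cs.simple, by simp, rfl, by simp⟩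
  refine le_antisymm (hω.eq ▸ Nat.sInf_le hmem) ?_
  obtain ⟨L, hL, hprod, hlen⟩ := Nat.sInf_mem ⟨_, hmem⟩
  obtain ⟨ω', rfl⟩ := (Set.range_list_map cs.simple).ge hL
  rw [wordLength, ← hlen, ← hprod, List.length_map]
  exact cs.length_wordProd_le ω'

theorem isEvenC0System : IsEvenC0System (Set.range cs.simple) where
  closure_eq_top := cs.subgroup_closure_range_simple
  inv_mem := by
    rintro _ ⟨i, rfl⟩
    exact ⟨i, (cs.inv_simple i).symm⟩
  one_notMem := by
    rintro ⟨i, hi⟩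
    simpa [hi] using cs.length_simple i
  exists_sign := by
    refine ⟨cs.lift ⟨fun _ => -1, fun i j => by simp⟩, ?_⟩
    rintro _ ⟨i, rfl⟩
    exact cs.lift_apply_simple _ i

theorem mem_rootHalfSpace_iff {x : Reflection cs × ℤˣ} {w : W} :
    w ∈ cs.rootHalfSpace x ↔ (cs.rootAction w⁻¹ x).2 = 1 := by
  have hsign : ∀ a b : ℤˣ, (a = 1 ∧ ¬ b ≠ a) ∨ (a = -1 ∧ b ≠ a) ↔ b = 1 := by decide
  have hinv : cs.length (x.1 * w) < cs.length w ↔ (cs.rootAction w⁻¹ x).2 ≠ x.2 := by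
    rw [← isLeftInversion_iff_rootAction_snd_ne, IsLeftInversion, and_iff_right x.1.2]
  have hnot : cs.length w < cs.length (x.1 * w) ↔ ¬ cs.length (x.1 * w) < cs.length w := by
    have := x.1.2.length_mul_right_ne w
    omega
  rw [rootHalfSpace, Set.mem_ofPred_eq, hnot, hinv]
  exact hsign _ _

theorem one_mem_rootHalfSpace_iff {x : Reflection cs × ℤˣ} : 1 ∈ cs.rootHalfSpace x ↔ x.2 = 1 := by
  rw [mem_rootHalfSpace_iff, inv_one, map_one, Equiv.Perm.one_apply]

theorem xor_mem_rootHalfSpace_iff {g : W} {x : Reflection cs × ℤˣ} :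
    Xor (1 ∈ cs.rootHalfSpace x) (g ∈ cs.rootHalfSpace x) ↔ x.1 ∈ 𝒩 g := by
  have hsign : ∀ a b : ℤˣ, Xor (a = 1) (b = 1) ↔ b ≠ a := by decide
  rw [one_mem_rootHalfSpace_iff, mem_rootHalfSpace_iff, mem_leftInversions_iff cs g x.1 x.2]
  exact hsign _ _

theorem smul_rootHalfSpace (g : W) (x : Reflection cs × ℤˣ) :
    g • cs.rootHalfSpace x = cs.rootHalfSpace (cs.rootAction g x) := by
  ext w
  rw [Set.mem_smul_set_iff_inv_smul_mem, mem_rootHalfSpace_iff, mem_rootHalfSpace_iff,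
    smul_eq_mul, mul_inv_rev, inv_inv, map_mul, Equiv.Perm.mul_apply]

theorem rootHalfSpace_neg (x : Reflection cs × ℤˣ) :
    cs.rootHalfSpace (x.1, -x.2) = (cs.rootHalfSpace x)ᶜ := by
  have hsign : ∀ a : ℤˣ, -a = 1 ↔ ¬ a = 1 := by decide
  ext w
  rw [Set.mem_compl_iff, mem_rootHalfSpace_iff, mem_rootHalfSpace_iff, rootAction_neg]
  exact hsign _

theorem rootHalfSpace_simpleRoot (i : B) :
    cs.rootHalfSpace (cs.simpleRoot i) = posHalf (Set.range cs.simple) (cs.simple i) := by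
  have hsign : (1 : ℤˣ) ≠ -1 := by decide
  ext w
  simp [rootHalfSpace, simpleRoot, posHalf, wordLength_range_simple, hsign]

theorem rootHalfSpace_injective : Function.Injective cs.rootHalfSpace := by
  intro x y hxy
  obtain ⟨g, i, rfl⟩ := exists_rootAction_simpleRoot cs x
  obtain ⟨z, rfl⟩ := (cs.rootAction g).surjective y
  rw [← smul_rootHalfSpace, ← smul_rootHalfSpace, smul_left_cancel_iff] at hxy
  have hz₂ : z.2 = 1 := by
    rw [← one_mem_rootHalfSpace_iff, ← hxy, one_mem_rootHalfSpace_iff]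
    rfl
  have hz₁ : z.1 ∈ 𝒩 (cs.simple i) := by
    rw [← xor_mem_rootHalfSpace_iff, ← hxy, xor_mem_rootHalfSpace_iff, leftInversions_simple]
    rfl
  rw [leftInversions_simple, Set.mem_singleton_iff] at hz₁
  exact congrArg _ (Prod.ext hz₁ hz₂).symm

theorem range_rootHalfSpace : Set.range cs.rootHalfSpace = halfSpaces (Set.range cs.simple) := by
  ext A
  constructor
  · rintro ⟨x, rfl⟩
    obtain ⟨g, i, rfl⟩ := exists_rootAction_simpleRoot cs x
    exact ⟨g, _, ⟨i, rfl⟩, by rw [← smul_rootHalfSpace, rootHalfSpace_simpleRoot]⟩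
  · rintro ⟨g, _, ⟨i, rfl⟩, rfl⟩
    exact ⟨cs.rootAction g (cs.simpleRoot i), by
      rw [← smul_rootHalfSpace, rootHalfSpace_simpleRoot]⟩

/-- The isomorphism `f : Φ → Ψ̂` from the abstract root system to the half-spaces. -/
noncomputable def rootEquivHalfSpaces :
    (Reflection cs × ℤˣ) ≃ halfSpaces (Set.range cs.simple) :=
  (Equiv.ofInjective _ (rootHalfSpace_injective cs)).trans
    (Equiv.setCongr (range_rootHalfSpace cs))

theorem rootEquivHalfSpaces_neg (x : Reflection cs × ℤˣ) :
    rootEquivHalfSpaces cs (x.1, -x.2) =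
      (isEvenC0System cs).signedHalfSpaces.neg (rootEquivHalfSpaces cs x) :=
  Subtype.ext (rootHalfSpace_neg cs x)

theorem isIso_rootEquivHalfSpaces :
    SignedGSet.IsIso (Φ := cs.abstractRootSystem) (Φ' := (isEvenC0System cs).signedHalfSpaces)
      (rootEquivHalfSpaces cs) where
  map_smul g x := Subtype.ext (smul_rootHalfSpace cs g x).symm
  map_neg x := rootEquivHalfSpaces_neg cs x
  bijective := (rootEquivHalfSpaces cs).bijective
  mem_pos_iff _ := one_mem_rootHalfSpace_iff cs

theorem eq_rootEquivHalfSpaces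
    {f : cs.abstractRootSystem.carrier → (isEvenC0System cs).signedHalfSpaces.carrier}
    (hf : ∀ (g : W) (x : cs.abstractRootSystem.carrier), f (g • x) = g • f x)
    (hs : ∀ i, (f (cs.simpleRoot i)).1 = posHalf (Set.range cs.simple) (cs.simple i)) :
    f = rootEquivHalfSpaces cs := by
  funext x
  obtain ⟨g, i, rfl⟩ := exists_rootAction_simpleRoot cs x
  have hi : f (cs.simpleRoot i) = rootEquivHalfSpaces cs (cs.simpleRoot i) :=
    Subtype.ext ((hs i).trans (rootHalfSpace_simpleRoot cs i).symm)
  exact (hf g _).trans ((congrArg (g • ·) hi).trans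
    ((isIso_rootEquivHalfSpaces cs).map_smul g (cs.simpleRoot i)).symm)

/-- The reflection `t` with `A = f(t, ±)`. -/
noncomputable def reflectionOfHalfSpace (A : halfSpaces (Set.range cs.simple)) : Reflection cs :=
  ((rootEquivHalfSpaces cs).symm A).1

theorem reflectionOfHalfSpace_surjective : Function.Surjective (reflectionOfHalfSpace cs) :=
  Prod.fst_surjective.comp (rootEquivHalfSpaces cs).symm.surjective

theorem xor_mem_halfSpace_iff {g : W} {A : halfSpaces (Set.range cs.simple)} :
    Xor (1 ∈ (A : Set W)) (g ∈ (A : Set W)) ↔ reflectionOfHalfSpace cs A ∈ 𝒩 g := by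
  obtain ⟨x, rfl⟩ := (rootEquivHalfSpaces cs).surjective A
  rw [reflectionOfHalfSpace, Equiv.symm_apply_apply]
  exact xor_mem_rootHalfSpace_iff cs

theorem reflectionOfHalfSpace_eq_iff {A A' : halfSpaces (Set.range cs.simple)} :
    reflectionOfHalfSpace cs A = reflectionOfHalfSpace cs A' ↔
      A = A' ∨ A = (isEvenC0System cs).signedHalfSpaces.neg A' := by
  have hsign : ∀ a b : ℤˣ, a = b ∨ a = -b := by decide
  obtain ⟨x, rfl⟩ := (rootEquivHalfSpaces cs).surjective A
  obtain ⟨y, rfl⟩ := (rootEquivHalfSpaces cs).surjective A'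
  rw [← rootEquivHalfSpaces_neg, (rootEquivHalfSpaces cs).apply_eq_iff_eq,
    (rootEquivHalfSpaces cs).apply_eq_iff_eq, reflectionOfHalfSpace, reflectionOfHalfSpace,
    Equiv.symm_apply_apply, Equiv.symm_apply_apply, Prod.ext_iff, Prod.ext_iff, ← and_or_left,
    and_iff_left (hsign _ _)]

theorem setProtorootoidOf_N (g : W) :
    (setProtorootoidOf (Set.range cs.simple)).N g = reflectionOfHalfSpace cs ⁻¹' 𝒩 g :=
  Set.ext fun _ => mem_setProtorootoidOf_N_iff.trans (xor_mem_halfSpace_iff cs)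

theorem rank_setProtorootoidOf (g : W) :
    (setProtorootoidOf (Set.range cs.simple)).toProtorootoid.rank g = 2 * ℓ g := by
  have hN : (setProtorootoidOf (Set.range cs.simple)).N g =
      (rootEquivHalfSpaces cs).symm ⁻¹' (𝒩 g ×ˢ Set.univ) := by
    rw [setProtorootoidOf_N, Set.prod_univ]
    rfl
  have hsigns : (Set.univ : Set ℤˣ).encard = 2 := by
    rw [Set.encard_univ, ENat.card_eq_coe_fintype_card]
    rfl
  rw [SetProtorootoid.rank_eq_encard_of_bijective (rootEquivHalfSpaces cs).symm.bijective hN,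
    Set.encard_prod, encard_leftInversions, hsigns, mul_comm]

theorem isC2System : IsC2System (Set.range cs.simple) where
  toIsC0System := (isEvenC0System cs).toIsC0System
  cocycleFinite g := by
    rw [rank_setProtorootoidOf]
    exact ENat.natCast_ne_top (2 * ℓ g)
  rank_eq g := by rw [rank_setProtorootoidOf, wordLength_range_simple]
  isRootoid := SetProtorootoid.isRootoid_of_surjective (isRootoid_inversionProtorootoid cs)
    (reflectionOfHalfSpace_surjective cs) (setProtorootoidOf_N cs)

/-- The reflection of a pair of opposite half-spaces, that is, of an element of `Ψ̂/{±}`. -/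
noncomputable def reflectionOfWall :
    Quotient (isEvenC0System cs).signedHalfSpaces.signSetoid → Reflection cs :=
  Quotient.lift (reflectionOfHalfSpace cs) fun _ _ => (reflectionOfHalfSpace_eq_iff cs).2

theorem reflectionOfWall_bijective : Function.Bijective (reflectionOfWall cs) := by
  refine ⟨?_, Quotient.lift_surjective _ _ (reflectionOfHalfSpace_surjective cs)⟩
  rintro ⟨A⟩ ⟨A'⟩ h
  exact Quotient.sound ((reflectionOfHalfSpace_eq_iff cs).1 h)

theorem signedHalfSpaces_N (g : W) :
    (isEvenC0System cs).signedHalfSpaces.toSetProtorootoid.N g = reflectionOfWall cs ⁻¹' 𝒩 g := by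
  ext ⟨A⟩
  exact (isEvenC0System cs).mk_mem_N_iff.trans (xor_mem_halfSpace_iff cs)

theorem rank_signedHalfSpaces (g : W) :
    (isEvenC0System cs).signedHalfSpaces.toSetProtorootoid.toProtorootoid.rank g = ℓ g := by
  rw [SetProtorootoid.rank_eq_encard_of_bijective (reflectionOfWall_bijective cs)
    (signedHalfSpaces_N cs g), encard_leftInversions]

theorem isRootoid_signedHalfSpaces :
    (isEvenC0System cs).signedHalfSpaces.toSetProtorootoid.toProtorootoid.IsRootoid :=
  SetProtorootoid.isRootoid_of_surjective (isRootoid_inversionProtorootoid cs)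
    (reflectionOfWall_bijective cs).surjective (signedHalfSpaces_N cs)

theorem simples_signedHalfSpaces :
    (isEvenC0System cs).signedHalfSpaces.toSetProtorootoid.toProtorootoid.simples =
      Set.range cs.simple := by
  ext g
  rw [Protorootoid.simples, Set.mem_ofPred_eq, rank_signedHalfSpaces, Nat.cast_eq_one,
    length_eq_one_iff]
  exact exists_congr fun _ => eq_comm

theorem isPrincipal_signedHalfSpaces :
    (isEvenC0System cs).signedHalfSpaces.toSetProtorootoid.toProtorootoid.IsPrincipal where
  faithful := (isRootoid_signedHalfSpaces cs).faithful
  cocycleFinite g := by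
    rw [rank_signedHalfSpaces]
    exact ENat.natCast_ne_top _
  closure_simples := by rw [simples_signedHalfSpaces, subgroup_closure_range_simple]
  rank_eq g := by rw [rank_signedHalfSpaces, simples_signedHalfSpaces, wordLength_range_simple]

end CoxeterRootoid

theorem proposition8p5 {B : Type*} {M : CoxeterMatrix B} {W : Type*} [Group W]
    (cs : CoxeterSystem M W) :
    ∃ hS : IsEvenC0System (Set.range cs.simple),
      IsC2System (Set.range cs.simple) ∧
      (∃ f : cs.abstractRootSystem.carrier → hS.signedHalfSpaces.carrier,
        SignedGSet.IsIso f ∧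
        (∀ i : B, (f (cs.simpleRoot i)).1 = posHalf (Set.range cs.simple) (cs.simple i)) ∧
        (∀ x, (f x).1 = cs.rootHalfSpace x) ∧
        ∀ f' : cs.abstractRootSystem.carrier → hS.signedHalfSpaces.carrier,
          SignedGSet.IsHom f' →
          (∀ i : B, (f' (cs.simpleRoot i)).1 = posHalf (Set.range cs.simple) (cs.simple i)) →
          f' = f) ∧
      hS.signedHalfSpaces.toSetProtorootoid.toProtorootoid.IsRootoid ∧
      hS.signedHalfSpaces.toSetProtorootoid.toProtorootoid.IsPrincipal ∧
      hS.signedHalfSpaces.toSetProtorootoid.toProtorootoid.simples = Set.range cs.simple := by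
  exact ⟨CoxeterRootoid.isEvenC0System cs, CoxeterRootoid.isC2System cs,
    ⟨CoxeterRootoid.rootEquivHalfSpaces cs, CoxeterRootoid.isIso_rootEquivHalfSpaces cs,
      CoxeterRootoid.rootHalfSpace_simpleRoot cs, fun _ => rfl,
      fun _ hf => CoxeterRootoid.eq_rootEquivHalfSpaces cs hf.map_smul⟩,
    CoxeterRootoid.isRootoid_signedHalfSpaces cs, CoxeterRootoid.isPrincipal_signedHalfSpaces cs,
    CoxeterRootoid.simples_signedHalfSpaces cs⟩
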